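/- Let $P\subseteq\mathbb{R}^d$ be a polytope with $\dim P\ge 1$. An extended formulation of $P$ is a finite system of linear inequalities and linear equations in some $\mathbb{R}^e$ with solution set $Q$, together with an affine map $\pi:\mathbb{R}^e\to\mathbb{R}^d$ such that $\pi(Q)=P$; its size is the number of inequalities. The extension complexity $\mathrm{xc}(P)$ is the smallest size of an extended formulation of $P$; equivalently, it is the smallest number of facets of a polytope $Q\subseteq\mathbb{R}^e$ (for any $e$) with $\pi(Q)=P$ for some affine map $\pi$. Let $Ax\le b$, with $A\in\mathbb{R}^{m\times d}$ and $b\in\mathbb{R}^m$, be any system with $P=\{x\in\mathbb{R}^d : Ax\le b\}$. A slack generating set of $P$ with respect to $Ax\le b$ is a finite set $T\subseteq\mathbb{R}^m_{\ge 0}$ such that for every $x\in P$ the slack vector $b-Ax$ is a nonnegative linear combination of the elements of $T$; its size is $|T|$. Then $\mathrm{xc}(P)$ (with either of the two descriptions above) is equal to the minimum size of a slack generating set of $P$ with respect to $Ax\le b$. -/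

import Mathlib

open scoped Matrix

/-- The solution set `{x | A x ≤ b}` of a finite system of linear inequalities. -/
def polyhedron {m d : ℕ} (A : Matrix (Fin m) (Fin d) ℝ) (b : Fin m → ℝ) : Set (Fin d → ℝ) :=
  {x | A *ᵥ x ≤ b}

/-- A polytope is a bounded solution set of a finite system of linear inequalities. -/
def IsPolytope {d : ℕ} (P : Set (Fin d → ℝ)) : Prop :=
  Bornology.IsBounded P ∧
    ∃ (m : ℕ) (A : Matrix (Fin m) (Fin d) ℝ) (b : Fin m → ℝ), polyhedron A b = P

open Classical in
/-- The affine dimension of a set, with the convention that the empty set has dimension `-1`. -/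
noncomputable def affineDim {d : ℕ} (S : Set (Fin d → ℝ)) : ℤ :=
  if S = ∅ then -1 else (Module.finrank ℝ (vectorSpan ℝ S) : ℤ)

/-- The facets of `Q`: the faces (exposed subsets, `∅` and `Q` included) of dimension
`dim Q - 1`. -/
def facets {e : ℕ} (Q : Set (Fin e → ℝ)) : Set (Set (Fin e → ℝ)) :=
  {F | IsExposed ℝ Q F ∧ affineDim F = affineDim Q - 1}

/-- An extended formulation of `P`: a system of `size` linear inequalities and of finitely many
linear equations in some `ℝ^e`, whose (possibly unbounded) solution set is mapped onto `P` by an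
affine map. Equations do not count for the size. -/
structure ExtendedFormulation {d : ℕ} (P : Set (Fin d → ℝ)) where
  /-- number of variables -/
  e : ℕ
  /-- number of inequalities -/
  size : ℕ
  /-- number of equations -/
  numEq : ℕ
  C : Matrix (Fin size) (Fin e) ℝ
  g : Fin size → ℝ
  D : Matrix (Fin numEq) (Fin e) ℝ
  h : Fin numEq → ℝ
  π : (Fin e → ℝ) →ᵃ[ℝ] (Fin d → ℝ)
  image_eq : π '' {y | C *ᵥ y ≤ g ∧ D *ᵥ y = h} = P

/-- An extension of `P`: a polytope `Q` along with an affine map that maps `Q` onto `P`. -/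
structure PolytopeExtension {d : ℕ} (P : Set (Fin d → ℝ)) where
  e : ℕ
  Q : Set (Fin e → ℝ)
  isPolytope : IsPolytope Q
  π : (Fin e → ℝ) →ᵃ[ℝ] (Fin d → ℝ)
  image_eq : π '' Q = P

/-- The extension complexity of `P`: the smallest size of an extended formulation of `P`. -/
noncomputable def extensionComplexity {d : ℕ} (P : Set (Fin d → ℝ)) : ℕ :=
  sInf {r | ∃ E : ExtendedFormulation P, E.size = r}

/-- The slack map `x ↦ b - A x`. -/
def slackMap {m d : ℕ} (A : Matrix (Fin m) (Fin d) ℝ) (b : Fin m → ℝ) (x : Fin d → ℝ) :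
    Fin m → ℝ :=
  b - A *ᵥ x

/-- `T` is a slack generating set of `P` with respect to `A x ≤ b`: a finite set of nonnegative
vectors such that every slack vector of a point of `P` is a nonnegative combination of `T`. -/
def IsSlackGeneratingSet {m d : ℕ} (P : Set (Fin d → ℝ)) (A : Matrix (Fin m) (Fin d) ℝ)
    (b : Fin m → ℝ) (T : Finset (Fin m → ℝ)) : Prop :=
  (∀ t ∈ T, 0 ≤ t) ∧
    ∀ s ∈ slackMap A b '' P, ∃ c : (Fin m → ℝ) → ℝ, (∀ t ∈ T, 0 ≤ c t) ∧ s = ∑ t ∈ T, c t • t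

/-! The three minima agree because of a cycle of conversions, none of which increases the size:
extended formulation to slack generating set to polytope extension and back.

Each slack of P, pulled back to the solution set of a formulation, is nonnegative there. By Farkas
it is a nonnegative combination of the formulation's slacks plus a constant k ≥ 0.
`nonneg_comp_eq_sum` absorbs k: P is compact with two points, so some coordinate has distinct
extrema; its two tight bounds need no constant and add up to a positive constant. The columns of the
matrix of multipliers then generate all slack vectors (Yannakakis' factorization).

Conversely, the c ≥ 0 for which ∑ c_t t (t ∈ T nonzero) is b - Ax for some x form a polytope
projecting onto P. Each of its facets is some c_t = 0 (`exists_eq_of_mem_facets`), so there are at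
most |T|. Finally, a nonempty polyhedron needs only one inequality per facet besides equations
(`exists_card_le_encard_facets`), and equations are free. -/

/-! ### Farkas' lemma and removal of the constant term -/

/-- **Farkas' lemma** for finitely many linear functionals on a real vector space. -/
theorem farkas_finset {V ι : Type*} [AddCommGroup V] [Module ℝ V] (t : Finset ι) :
    ∀ (f : ι → V →ₗ[ℝ] ℝ) (g : V →ₗ[ℝ] ℝ), (∀ x, (∀ i ∈ t, 0 ≤ f i x) → 0 ≤ g x) →
      ∃ c : ι → ℝ, (∀ i, 0 ≤ c i) ∧ g = ∑ i ∈ t, c i • f i := by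
  classical
  induction t using Finset.induction_on with
  | empty =>
    intro f g h
    refine ⟨0, fun _ => le_rfl, ?_⟩
    ext x
    have h1 := h x (by simp)
    have h2 := h (-x) (by simp)
    rw [map_neg] at h2
    simp
    linarith
  | insert a t ha ih =>
    intro f g h
    by_cases hg : ∀ x, (∀ i ∈ t, 0 ≤ f i x) → 0 ≤ g x
    · obtain ⟨c, hc, rfl⟩ := ih f g hg
      refine ⟨Function.update c a 0, fun i => ?_, ?_⟩
      · by_cases hi : i = a
        · subst hi; simp
        · simp [hi, hc]
      · rw [Finset.sum_insert ha]
        simp only [Function.update_self, zero_smul, zero_add]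
        refine Finset.sum_congr rfl fun i hi => ?_
        rw [Function.update_of_ne (ne_of_mem_of_not_mem hi ha)]
    · push Not at hg
      obtain ⟨x, hx, hgx⟩ := hg
      have hax : f a x < 0 := by
        by_contra hax
        push Not at hax
        refine absurd (h x fun i hi => ?_) hgx.not_ge
        rcases Finset.mem_insert.1 hi with rfl | hi
        · exact hax
        · exact hx i hi
      -- Compose all functionals with the projection onto ker (f a) along x, and apply induction
      -- there.
      obtain ⟨c, hc, hgc⟩ := ih (fun i => f i - (f i x / f a x) • f a)
        (g - (g x / f a x) • f a) (fun y hy => by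
          have := h (y - (f a y / f a x) • x) (fun i hi => by
            rcases Finset.mem_insert.1 hi with rfl | hi
            · simp [hax.ne]
            · have := hy i hi
              simp only [LinearMap.sub_apply, LinearMap.smul_apply, smul_eq_mul, map_sub,
                map_smul] at this ⊢
              convert this using 2
              ring)
          simp only [LinearMap.sub_apply, LinearMap.smul_apply, smul_eq_mul, map_sub,
            map_smul] at this ⊢
          convert this using 2
          ring)
      refine ⟨Function.update c a (g x / f a x - ∑ i ∈ t, c i * (f i x / f a x)), fun i => ?_, ?_⟩
      · by_cases hi : i = a
        · subst hi
          simp only [Function.update_self, sub_nonneg]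
          refine (Finset.sum_nonpos fun j hj => ?_).trans (div_nonneg_of_nonpos hgx.le hax.le)
          exact mul_nonpos_of_nonneg_of_nonpos (hc j)
            (div_nonpos_of_nonneg_of_nonpos (hx j hj) hax.le)
        · simp [hi, hc]
      · rw [Finset.sum_insert ha]
        have h1 : ∑ i ∈ t, Function.update c a
            (g x / f a x - ∑ i ∈ t, c i * (f i x / f a x)) i • f i = ∑ i ∈ t, c i • f i :=
          Finset.sum_congr rfl fun i hi => by
            rw [Function.update_of_ne (ne_of_mem_of_not_mem hi ha)]
        have h2 : ∑ i ∈ t, c i • (f i - (f i x / f a x) • f a) =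
            ∑ i ∈ t, c i • f i - (∑ i ∈ t, c i * (f i x / f a x)) • f a := by
          simp only [smul_sub, Finset.sum_sub_distrib, Finset.sum_smul, smul_smul]
        rw [h2, sub_eq_iff_eq_add] at hgc
        rw [h1, Function.update_self]
        refine hgc.trans ?_
        have h3 : ∀ r q : ℝ, (r - q) • f a = r • f a - q • f a := fun r q => sub_smul r q (f a)
        rw [h3]
        abel

theorem AffineMap.apply_add {V W : Type*} [AddCommGroup V] [Module ℝ V] [AddCommGroup W]
    [Module ℝ W] (s : V →ᵃ[ℝ] W) (x v : V) : s (x + v) = s x + s.linear v := by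
  have := s.map_vadd x v
  simpa [add_comm] using this

theorem AffineMap.apply_eq_zero_add_linear {V W : Type*} [AddCommGroup V] [Module ℝ V]
    [AddCommGroup W] [Module ℝ W] (s : V →ᵃ[ℝ] W) (x : V) : s x = s 0 + s.linear x := by
  simpa using s.apply_add 0 x

/-- The affine form of **Farkas' lemma**. -/
theorem affine_farkas {V ι : Type*} [AddCommGroup V] [Module ℝ V] [Fintype ι]
    (s : ι → V →ᵃ[ℝ] ℝ) (φ : V →ᵃ[ℝ] ℝ) (hne : ∃ y, ∀ i, 0 ≤ s i y)
    (h : ∀ y, (∀ i, 0 ≤ s i y) → 0 ≤ φ y) :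
    ∃ (k : ℝ) (c : ι → ℝ), 0 ≤ k ∧ (∀ i, 0 ≤ c i) ∧ ∀ y, φ y = k + ∑ i, c i * s i y := by
  obtain ⟨y₀, hy₀⟩ := hne
  -- Homogenization: `none` stands for the extra inequality τ ≥ 0, and its multiplier becomes the
  -- constant k.
  let hom : (V →ᵃ[ℝ] ℝ) → (V × ℝ →ₗ[ℝ] ℝ) := fun a =>
    a.linear ∘ₗ LinearMap.fst ℝ V ℝ + a 0 • LinearMap.snd ℝ V ℝ
  have hom_apply : ∀ a v τ, hom a (v, τ) = a.linear v + a 0 * τ := fun a v τ => by simp [hom]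
  let f : Option ι → (V × ℝ →ₗ[ℝ] ℝ) := fun o => o.elim (LinearMap.snd ℝ V ℝ) (fun i => hom (s i))
  obtain ⟨c, hc, hg⟩ := farkas_finset Finset.univ f (hom φ) (by
    rintro ⟨v, τ⟩ hv
    have hτ : 0 ≤ τ := by simpa [f] using hv none (Finset.mem_univ _)
    have hs : ∀ i, 0 ≤ (s i).linear v + s i 0 * τ := fun i => by
      simpa [f, hom_apply] using hv (some i) (Finset.mem_univ _)
    rw [hom_apply]
    rcases hτ.eq_or_lt with rfl | hτ
    -- Here v is a recession direction. If φ decreased along it, the step length below would bring φ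
    -- from φ y₀ to -1.
    · simp only [mul_zero, add_zero] at hs ⊢
      by_contra hneg
      push Not at hneg
      have h1 := h (y₀ + ((φ y₀ + 1) / (-φ.linear v)) • v) (fun i => by
        rw [AffineMap.apply_add, map_smul, smul_eq_mul]
        have h0 : 0 ≤ φ y₀ := h y₀ hy₀
        exact add_nonneg (hy₀ i) (mul_nonneg (div_nonneg (by linarith) (by linarith)) (hs i)))
      rw [AffineMap.apply_add, map_smul, smul_eq_mul] at h1
      have h2 : (φ y₀ + 1) / (-φ.linear v) * φ.linear v = -(φ y₀ + 1) := by
        field_simp [hneg.ne]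
      linarith
    · have key : ∀ a : V →ᵃ[ℝ] ℝ, a.linear v + a 0 * τ = τ * a (τ⁻¹ • v) := fun a => by
        rw [AffineMap.apply_eq_zero_add_linear a (τ⁻¹ • v), map_smul, smul_eq_mul]
        field_simp
        ring
      rw [key]
      refine mul_nonneg hτ.le (h _ fun i => ?_)
      have := hs i
      rw [key] at this
      exact nonneg_of_mul_nonneg_right this hτ)
  refine ⟨c none, fun i => c (some i), hc _, fun i => hc _, fun y => ?_⟩
  have h1 := LinearMap.congr_fun hg (y, 1)
  rw [hom_apply, mul_one, add_comm, ← AffineMap.apply_eq_zero_add_linear] at h1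
  rw [h1, Fintype.sum_option]
  simp only [LinearMap.add_apply, LinearMap.smul_apply, LinearMap.sum_apply, smul_eq_mul, f,
    Option.elim_none, Option.elim_some, LinearMap.snd_apply, mul_one, hom_apply]
  congr 1
  refine Finset.sum_congr rfl fun i _ => ?_
  rw [add_comm ((s i).linear y), ← AffineMap.apply_eq_zero_add_linear]

/-- If the polyhedron `{y | ∀ i, 0 ≤ s i y}` has a compact image with at least two points, then
every affine function that is nonnegative on the image is a nonnegative combination of the `s i`,
without a constant term. -/
theorem nonneg_comp_eq_sum {V ι κ : Type*} [AddCommGroup V] [Module ℝ V] [Fintype ι]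
    (s : ι → V →ᵃ[ℝ] ℝ) (π : V →ᵃ[ℝ] (κ → ℝ)) {P : Set (κ → ℝ)}
    (himage : π '' {y | ∀ i, 0 ≤ s i y} = P) (hP : IsCompact P) (hnt : P.Nontrivial)
    (φ : (κ → ℝ) →ᵃ[ℝ] ℝ) (hφ : ∀ x ∈ P, 0 ≤ φ x) :
    ∃ c : ι → ℝ, (∀ i, 0 ≤ c i) ∧ ∀ y, φ (π y) = ∑ i, c i * s i y := by
  obtain ⟨p, hp, q, hq, hpq⟩ := hnt
  obtain ⟨a, ha⟩ := Function.ne_iff.1 hpq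
  have hmem : ∀ y, (∀ i, 0 ≤ s i y) → π y ∈ P := fun y hy => himage ▸ ⟨y, hy, rfl⟩
  have hpre : ∀ x ∈ P, ∃ y, (∀ i, 0 ≤ s i y) ∧ π y = x := fun x hx => by
    rw [← himage] at hx; exact hx
  have hne : ∃ y, ∀ i, 0 ≤ s i y := let ⟨y, hy, _⟩ := hpre p hp; ⟨y, hy⟩
  -- At a zero of ψ on P, both k and the combination are nonnegative with sum 0, so k = 0.
  have tight : ∀ ψ : (κ → ℝ) →ᵃ[ℝ] ℝ, (∀ x ∈ P, 0 ≤ ψ x) → (∃ x ∈ P, ψ x = 0) →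
      ∃ c : ι → ℝ, (∀ i, 0 ≤ c i) ∧ ∀ y, ψ (π y) = ∑ i, c i * s i y := by
    rintro ψ hψ ⟨x, hx, hx0⟩
    obtain ⟨k, c, hk, hc, h⟩ := affine_farkas s (ψ.comp π) hne fun y hy => hψ _ (hmem y hy)
    obtain ⟨y, hy, rfl⟩ := hpre x hx
    have hk0 : k = 0 := by
      have h1 := h y
      have h2 : 0 ≤ ∑ i, c i * s i y := Finset.sum_nonneg fun i _ => mul_nonneg (hc i) (hy i)
      rw [AffineMap.comp_apply, hx0] at h1
      linarith
    refine ⟨c, hc, fun y => ?_⟩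
    simpa [hk0] using h y
  have hcont : ContinuousOn (fun x : κ → ℝ => x a) P := (continuous_apply a).continuousOn
  obtain ⟨u, hu, hmin⟩ := hP.exists_isMinOn ⟨p, hp⟩ hcont
  obtain ⟨v, hv, hmax⟩ := hP.exists_isMaxOn ⟨p, hp⟩ hcont
  have hlt : u a < v a := by
    have h1 : u a ≤ p a := hmin hp
    have h2 : u a ≤ q a := hmin hq
    have h3 : p a ≤ v a := hmax hp
    have h4 : q a ≤ v a := hmax hq
    rcases lt_or_gt_of_ne ha with h | h <;> linarith
  let coord : (κ → ℝ) →ᵃ[ℝ] ℝ := (LinearMap.proj a : (κ → ℝ) →ₗ[ℝ] ℝ).toAffineMap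
  have hcoord : ∀ x, coord x = x a := fun x => rfl
  obtain ⟨c₁, hc₁, h₁⟩ := tight (coord - AffineMap.const ℝ _ (u a))
    (fun x hx => by simpa [hcoord] using hmin hx) ⟨u, hu, by simp [hcoord]⟩
  obtain ⟨c₂, hc₂, h₂⟩ := tight (AffineMap.const ℝ _ (v a) - coord)
    (fun x hx => by simpa [hcoord] using hmax hx) ⟨v, hv, by simp [hcoord]⟩
  obtain ⟨k, c, hk, hc, h⟩ := affine_farkas s (φ.comp π) hne fun y hy => hφ _ (hmem y hy)
  have hpos : 0 < v a - u a := sub_pos.2 hlt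
  -- k is rewritten as k / (v a - u a) times the sum of the two tight functions, which is v a - u a.
  refine ⟨fun i => c i + k / (v a - u a) * (c₁ i + c₂ i), fun i => ?_, fun y => ?_⟩
  · exact add_nonneg (hc i) (mul_nonneg (div_nonneg hk hpos.le) (add_nonneg (hc₁ i) (hc₂ i)))
  · have e : ∑ i, (c i + k / (v a - u a) * (c₁ i + c₂ i)) * s i y =
        ∑ i, c i * s i y + k / (v a - u a) * (∑ i, c₁ i * s i y + ∑ i, c₂ i * s i y) := by
      rw [← Finset.sum_add_distrib, Finset.mul_sum, ← Finset.sum_add_distrib]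
      exact Finset.sum_congr rfl fun i _ => by ring
    have hy := h y
    rw [AffineMap.comp_apply] at hy
    rw [e, ← h₁, ← h₂, hy]
    simp only [AffineMap.coe_sub, Pi.sub_apply, AffineMap.const_apply]
    field_simp
    ring

/-! ### Relative interior points and affine dimension -/

/-- A midpoint is positive wherever either endpoint is, so finitely many witnesses merge into one.
The result plays the role of a relative interior point. -/
theorem exists_mem_forall_pos {V ι : Type*} [AddCommGroup V] [Module ℝ V] (t : Finset ι)
    (s : ι → V →ᵃ[ℝ] ℝ) {C : Set V} (hC : Convex ℝ C) (hne : C.Nonempty)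
    (hs : ∀ x ∈ C, ∀ i, 0 ≤ s i x) :
    ∃ z ∈ C, ∀ i ∈ t, (∃ x ∈ C, 0 < s i x) → 0 < s i z := by
  classical
  induction t using Finset.induction_on with
  | empty => exact ⟨hne.some, hne.some_mem, by simp⟩
  | insert a t ha ih =>
    obtain ⟨z, hz, hpos⟩ := ih
    by_cases hx : ∃ x ∈ C, 0 < s a x
    · obtain ⟨x, hx, hxa⟩ := hx
      have hmid : ∀ i, s i (midpoint ℝ z x) = (s i z + s i x) / 2 := fun i => by
        rw [AffineMap.map_midpoint, midpoint_eq_smul_add, smul_eq_mul, invOf_eq_inv]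
        ring
      refine ⟨midpoint ℝ z x, hC.midpoint_mem hz hx, fun i hi hix => ?_⟩
      rw [hmid]
      have h1 := hs z hz i
      have h2 := hs x hx i
      rcases Finset.mem_insert.1 hi with rfl | hi
      · linarith
      · have := hpos i hi hix
        linarith
    · refine ⟨z, hz, fun i hi hix => ?_⟩
      rcases Finset.mem_insert.1 hi with rfl | hi
      · exact absurd hix hx
      · exact hpos i hi hix

theorem exists_pos_forall_apply_add_smul_pos {V ι : Type*} [AddCommGroup V] [Module ℝ V]
    [Finite ι] (s : ι → V →ᵃ[ℝ] ℝ) (z v : V) :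
    ∃ ε : ℝ, 0 < ε ∧ ∀ i, 0 < s i z → 0 < s i (z + ε • v) := by
  have h : ∀ᶠ ε : ℝ in nhdsWithin 0 (Set.Ioi 0), ∀ i, 0 < s i z → 0 < s i (z + ε • v) := by
    refine Filter.eventually_all.2 fun i => ?_
    by_cases hi : 0 < s i z
    · have hc : Continuous fun ε : ℝ => s i z + ε * (s i).linear v := by fun_prop
      have ht := (hc.tendsto 0).eventually (lt_mem_nhds (a := 0) (by simpa using hi))
      filter_upwards [nhdsWithin_le_nhds ht] with ε hε _
      rwa [AffineMap.apply_add, map_smul, smul_eq_mul]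
    · exact Filter.Eventually.of_forall fun _ h => absurd h hi
  obtain ⟨ε, hε, hpos⟩ := (h.and self_mem_nhdsWithin).exists
  exact ⟨ε, hpos, hε⟩

theorem affineDim_of_nonempty {d : ℕ} {S : Set (Fin d → ℝ)} (h : S.Nonempty) :
    affineDim S = Module.finrank ℝ (vectorSpan ℝ S) := by
  rw [affineDim, if_neg h.ne_empty]

theorem nontrivial_of_one_le_affineDim {d : ℕ} {S : Set (Fin d → ℝ)} (h : 1 ≤ affineDim S) :
    S.Nontrivial := by
  have hne : S.Nonempty := by
    by_contra hne
    rw [Set.not_nonempty_iff_eq_empty] at hne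
    rw [affineDim, if_pos hne] at h
    omega
  by_contra hS
  rw [Set.not_nontrivial_iff] at hS
  rw [affineDim_of_nonempty hne, vectorSpan_of_subsingleton ℝ hS, finrank_bot] at h
  simp at h

theorem one_le_affineDim_of_nontrivial {d : ℕ} {S : Set (Fin d → ℝ)} (h : S.Nontrivial) :
    1 ≤ affineDim S := by
  obtain ⟨p, hp, q, hq, hpq⟩ := h
  rw [affineDim_of_nonempty ⟨p, hp⟩]
  have : vectorSpan ℝ S ≠ ⊥ := fun h0 => by
    have := vsub_mem_vectorSpan ℝ hp hq
    rw [h0, Submodule.mem_bot, vsub_eq_sub, sub_eq_zero] at this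
    exact hpq this
  have := Submodule.one_le_finrank_iff.2 this
  exact_mod_cast this

/-- The linear part of an affine function which is constant on a set vanishes on its direction. -/
theorem vectorSpan_le_ker_linear {V W : Type*} [AddCommGroup V] [Module ℝ V] [AddCommGroup W]
    [Module ℝ W] {S : Set V} (s : V →ᵃ[ℝ] W) {w : W} (h : ∀ x ∈ S, s x = w) :
    vectorSpan ℝ S ≤ LinearMap.ker s.linear := by
  rw [vectorSpan_def, Submodule.span_le]
  rintro _ ⟨x, hx, y, hy, rfl⟩
  rw [SetLike.mem_coe, LinearMap.mem_ker, AffineMap.linearMap_vsub, h x hx, h y hy, vsub_self]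

/-! ### Affine functions as matrix systems -/

theorem exists_matrix_of_affineMap {m e : ℕ} (s : Fin m → (Fin e → ℝ) →ᵃ[ℝ] ℝ) :
    ∃ (C : Matrix (Fin m) (Fin e) ℝ) (g : Fin m → ℝ), ∀ y i, g i - (C *ᵥ y) i = s i y := by
  refine ⟨LinearMap.toMatrix' (LinearMap.pi fun i => -(s i).linear), fun i => s i 0,
    fun y i => ?_⟩
  rw [LinearMap.toMatrix'_mulVec, AffineMap.apply_eq_zero_add_linear (s i) y]
  simp

theorem exists_polyhedron_eq {e : ℕ} {ι : Type*} [Fintype ι] (s : ι → (Fin e → ℝ) →ᵃ[ℝ] ℝ) :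
    ∃ (m : ℕ) (C : Matrix (Fin m) (Fin e) ℝ) (g : Fin m → ℝ),
      polyhedron C g = {y | ∀ i, 0 ≤ s i y} := by
  obtain ⟨C, g, h⟩ := exists_matrix_of_affineMap fun i => s ((Fintype.equivFin ι).symm i)
  refine ⟨_, C, g, Set.ext fun y => ?_⟩
  simp only [polyhedron, Set.mem_ofPred_eq, Pi.le_def]
  rw [← (Fintype.equivFin ι).symm.forall_congr_right]
  exact forall_congr' fun i => by rw [← h, sub_nonneg]

theorem exists_extendedFormulation {d e : ℕ} {ι κ : Type*} [Fintype ι] [Fintype κ]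
    {P : Set (Fin d → ℝ)} (s : ι → (Fin e → ℝ) →ᵃ[ℝ] ℝ) (h : κ → (Fin e → ℝ) →ᵃ[ℝ] ℝ)
    (π : (Fin e → ℝ) →ᵃ[ℝ] (Fin d → ℝ))
    (hπ : π '' {y | (∀ i, 0 ≤ s i y) ∧ ∀ k, h k y = 0} = P) :
    ∃ E : ExtendedFormulation P, E.size = Fintype.card ι := by
  obtain ⟨C, g, hC⟩ := exists_matrix_of_affineMap fun i => s ((Fintype.equivFin ι).symm i)
  obtain ⟨D, b, hD⟩ := exists_matrix_of_affineMap fun k => h ((Fintype.equivFin κ).symm k)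
  refine ⟨⟨e, _, _, C, g, D, b, π, ?_⟩, rfl⟩
  rw [← hπ]
  congr 1
  ext y
  simp only [Set.mem_ofPred_eq, Pi.le_def, funext_iff]
  rw [← (Fintype.equivFin ι).symm.forall_congr_right,
    ← (Fintype.equivFin κ).symm.forall_congr_right]
  refine and_congr (forall_congr' fun i => ?_) (forall_congr' fun k => ?_)
  · rw [← hC, sub_nonneg]
  · rw [← hD, sub_eq_zero, eq_comm]

/-- The affine function `x ↦ b i - (A x) i`. -/
noncomputable def slackFun {m d : ℕ} (A : Matrix (Fin m) (Fin d) ℝ) (b : Fin m → ℝ) (i : Fin m) :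
    (Fin d → ℝ) →ᵃ[ℝ] ℝ :=
  AffineMap.const ℝ _ (b i) - (LinearMap.proj i ∘ₗ A.mulVecLin).toAffineMap

theorem slackFun_apply {m d : ℕ} (A : Matrix (Fin m) (Fin d) ℝ) (b : Fin m → ℝ) (i : Fin m)
    (x : Fin d → ℝ) : slackFun A b i x = b i - (A *ᵥ x) i := by
  simp [slackFun]

theorem mem_polyhedron_iff {m d : ℕ} (A : Matrix (Fin m) (Fin d) ℝ) (b : Fin m → ℝ)
    (x : Fin d → ℝ) : x ∈ polyhedron A b ↔ ∀ i, 0 ≤ slackFun A b i x := by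
  simp only [polyhedron, Set.mem_ofPred_eq, Pi.le_def, slackFun_apply, sub_nonneg]

theorem isClosed_polyhedron {m d : ℕ} (A : Matrix (Fin m) (Fin d) ℝ) (b : Fin m → ℝ) :
    IsClosed (polyhedron A b) :=
  isClosed_le (by fun_prop) continuous_const

theorem IsPolytope.isCompact {d : ℕ} {P : Set (Fin d → ℝ)} (hP : IsPolytope P) : IsCompact P := by
  obtain ⟨hb, m, A, b, rfl⟩ := hP
  exact Metric.isCompact_of_isClosed_isBounded (isClosed_polyhedron A b) hb

theorem convex_setOf_nonneg {V ι : Type*} [AddCommGroup V] [Module ℝ V] (s : ι → V →ᵃ[ℝ] ℝ) :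
    Convex ℝ {y | ∀ i, 0 ≤ s i y} := by
  have : {y | ∀ i, 0 ≤ s i y} = ⋂ i, s i ⁻¹' Set.Ici 0 := by ext; simp
  rw [this]
  exact convex_iInter fun i => (convex_Ici 0).affine_preimage (s i)

theorem convex_setOf_eq_zero {V κ : Type*} [AddCommGroup V] [Module ℝ V] (h : κ → V →ᵃ[ℝ] ℝ) :
    Convex ℝ {y | ∀ k, h k y = 0} := by
  have : {y | ∀ k, h k y = 0} = ⋂ k, h k ⁻¹' {0} := by ext; simp
  rw [this]
  exact convex_iInter fun k => (convex_singleton 0).affine_preimage (h k)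

/-! ### Facets and inequalities -/

/-- The facets of a polyhedron given by inequalities and equations come from the inequalities. -/
theorem exists_eq_of_mem_facets {e : ℕ} {ι κ : Type*} [Fintype ι]
    (s : ι → (Fin e → ℝ) →ᵃ[ℝ] ℝ) (h : κ → (Fin e → ℝ) →ᵃ[ℝ] ℝ) {Q F : Set (Fin e → ℝ)}
    (hQ : Q = {y | (∀ i, 0 ≤ s i y) ∧ ∀ k, h k y = 0}) (hdim : 1 ≤ affineDim Q)
    (hF : F ∈ facets Q) : ∃ i, F = {y ∈ Q | s i y = 0} := by
  obtain ⟨hexp, hFdim⟩ := hF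
  -- The empty face has dimension -1, so it counts as a facet exactly when dim Q = 0; this is
  -- excluded by `hdim`.
  have hFne : F.Nonempty := by
    by_contra hne
    rw [Set.not_nonempty_iff_eq_empty] at hne
    rw [affineDim, if_pos hne] at hFdim
    omega
  have hQconv : Convex ℝ Q := hQ ▸ (convex_setOf_nonneg s).inter (convex_setOf_eq_zero h)
  have hsQ : ∀ y ∈ Q, ∀ i, 0 ≤ s i y := fun y hy => by rw [hQ] at hy; exact hy.1
  have hhQ : ∀ y ∈ Q, ∀ k, h k y = 0 := fun y hy => by rw [hQ] at hy; exact hy.2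
  have hFQ := hexp.subset
  have hFconv := hexp.convex hQconv
  obtain ⟨l, hl⟩ := hexp hFne
  obtain ⟨z, hz, hzpos⟩ := exists_mem_forall_pos Finset.univ s hFconv hFne
    fun x hx => hsQ x (hFQ hx)
  -- Otherwise, from z one can move slightly away from any y ∈ Q and stay in Q. As l is maximal at
  -- z, this forces l z ≤ l y, whence F = Q.
  have hex : ∃ i, (∀ x ∈ F, s i x = 0) ∧ ∃ y ∈ Q, s i y ≠ 0 := by
    by_contra hcon
    push Not at hcon
    have hQF : Q ⊆ F := fun y hy => by
      obtain ⟨ε, hε, hpos⟩ := exists_pos_forall_apply_add_smul_pos s z (z - y)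
      have hmem : z + ε • (z - y) ∈ Q := by
        rw [hQ]
        refine ⟨fun i => ?_, fun k => ?_⟩
        · rcases (hsQ z (hFQ hz) i).lt_or_eq with hi | hi
          · exact (hpos i hi).le
          · have h0 : ∀ x ∈ F, s i x = 0 := fun x hx => by
              by_contra hne
              have := hzpos i (Finset.mem_univ _)
                ⟨x, hx, (hsQ x (hFQ hx) i).lt_of_ne (Ne.symm hne)⟩
              exact this.ne hi
            have h1 := hcon i h0
            have h2 := (s i).linearMap_vsub z y
            rw [vsub_eq_sub, vsub_eq_sub, ← hi, h1 y hy, sub_self] at h2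
            rw [AffineMap.apply_add, map_smul, h2, ← hi]
            simp
        · have h2 := (h k).linearMap_vsub z y
          rw [vsub_eq_sub, vsub_eq_sub, hhQ z (hFQ hz), hhQ y hy, sub_self] at h2
          rw [AffineMap.apply_add, map_smul, h2, hhQ z (hFQ hz)]
          simp
      rw [hl] at hz ⊢
      have h1 := hz.2 _ hmem
      simp only [map_add, map_smul, map_sub, smul_eq_mul] at h1
      have h2 : l z ≤ l y := by
        by_contra hlt
        push Not at hlt
        have := mul_pos hε (sub_pos.2 hlt)
        linarith
      exact ⟨hy, fun x hx => (hz.2 x hx).trans h2⟩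
    rw [hFQ.antisymm hQF] at hFdim
    omega
  obtain ⟨i, hi, y, hy, hyi⟩ := hex
  refine ⟨i, Set.Subset.antisymm (fun x hx => ⟨hFQ hx, hi x hx⟩) fun x hx => ?_⟩
  set G := {y ∈ Q | s i y = 0} with hG
  have hFG : F ⊆ G := fun x hx => ⟨hFQ hx, hi x hx⟩
  -- F ⊆ G with dim F = dim Q - 1 and dim G < dim Q, so F and G have the same direction; l is
  -- constant on F, hence on G.
  have hlt : vectorSpan ℝ G < vectorSpan ℝ Q := by
    refine lt_of_le_of_ne (vectorSpan_mono ℝ fun x hx => hx.1) fun heq => hyi ?_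
    have h1 : y -ᵥ z ∈ vectorSpan ℝ G := heq ▸ vsub_mem_vectorSpan ℝ hy (hFQ hz)
    have h2 := vectorSpan_le_ker_linear (s i) (fun x hx => hx.2) h1
    rw [LinearMap.mem_ker, AffineMap.linearMap_vsub, vsub_eq_sub, hi z hz, sub_zero] at h2
    exact h2
  have hle : vectorSpan ℝ F ≤ vectorSpan ℝ G := vectorSpan_mono ℝ hFG
  have hFGspan : vectorSpan ℝ F = vectorSpan ℝ G := by
    refine Submodule.eq_of_le_of_finrank_le hle ?_
    have h1 := Submodule.finrank_lt_finrank_of_lt hlt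
    rw [affineDim_of_nonempty hFne, affineDim_of_nonempty ⟨y, hy⟩] at hFdim
    omega
  have h1 : x -ᵥ z ∈ vectorSpan ℝ F := hFGspan ▸ vsub_mem_vectorSpan ℝ hx (hFG hz)
  have hlF : ∀ w ∈ F, l w = l z := fun w hw => by
    rw [hl] at hw hz
    exact le_antisymm (hz.2 _ hw.1) (hw.2 _ hz.1)
  have h2 := vectorSpan_le_ker_linear (l : (Fin e → ℝ) →ₗ[ℝ] ℝ).toAffineMap hlF h1
  rw [LinearMap.mem_ker, AffineMap.linearMap_vsub, vsub_eq_sub, sub_eq_zero] at h2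
  have h3 : l x = l z := h2
  rw [hl] at hz ⊢
  exact ⟨hx.1, fun w hw => (hz.2 w hw).trans h3.ge⟩

/-- The facets of a polyhedron suffice to describe it inside its affine hull. -/
theorem exists_card_le_encard_facets {e : ℕ} {ι : Type*} [Fintype ι]
    (s : ι → (Fin e → ℝ) →ᵃ[ℝ] ℝ) {Q : Set (Fin e → ℝ)} (hQ : Q = {y | ∀ i, 0 ≤ s i y})
    (hne : Q.Nonempty) : ∃ S I : Finset ι,
      Q = {y | (∀ i ∈ S, 0 ≤ s i y) ∧ ∀ i ∈ I, s i y = 0} ∧ (S.card : ℕ∞) ≤ (facets Q).encard := by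
  classical
  let I : Finset ι := {i | ∀ y ∈ Q, s i y = 0}
  have hI : ∀ i, i ∈ I ↔ ∀ y ∈ Q, s i y = 0 := fun i => by simp [I]
  have hsQ : ∀ y ∈ Q, ∀ i, 0 ≤ s i y := fun y hy => by rw [hQ] at hy; exact hy
  let good : Set (Finset ι) := {S | Q = {y | (∀ i ∈ S, 0 ≤ s i y) ∧ ∀ i ∈ I, s i y = 0}}
  have hgood : good.Nonempty := by
    refine ⟨Finset.univ, Set.ext fun y => ⟨fun hy => ⟨fun i _ => hsQ y hy i,
      fun i hi => (hI i).1 hi y hy⟩, fun hy => ?_⟩⟩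
    rw [hQ]
    exact fun i => hy.1 i (Finset.mem_univ _)
  -- A minimal S is irredundant: dropping any i ∈ S admits a point w violating only i.
  obtain ⟨S, hS, hmin⟩ := Set.exists_min_image good Finset.card (Set.toFinite _) hgood
  refine ⟨S, I, hS, ?_⟩
  have hSQ : ∀ y, (∀ i ∈ S, 0 ≤ s i y) → (∀ i ∈ I, s i y = 0) → y ∈ Q := fun y h1 h2 => by
    have hS' : Q = {y | (∀ i ∈ S, 0 ≤ s i y) ∧ ∀ i ∈ I, s i y = 0} := hS
    rw [hS']
    exact ⟨h1, h2⟩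
  have hirr : ∀ i ∈ S, ∃ w, (∀ j ∈ S, j ≠ i → 0 ≤ s j w) ∧ (∀ j ∈ I, s j w = 0) ∧ s i w < 0 := by
    intro i hi
    by_contra hcon
    push Not at hcon
    have : S.erase i ∈ good := by
      refine Set.ext fun y => ⟨fun hy => ⟨fun j _ => hsQ y hy j, fun j hj => (hI j).1 hj y hy⟩,
        fun hy => ?_⟩
      have h1 : ∀ j ∈ S, j ≠ i → 0 ≤ s j y := fun j hj hji => hy.1 j (Finset.mem_erase.2 ⟨hji, hj⟩)
      refine hSQ y (fun j hj => ?_) hy.2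
      by_cases hji : j = i
      · exact hji ▸ hcon y h1 hy.2
      · exact h1 j hj hji
    exact absurd (hmin _ this) (Finset.card_erase_lt_of_mem hi).not_ge
  have hQconv : Convex ℝ Q := hQ ▸ convex_setOf_nonneg s
  obtain ⟨z, hz, hzpos⟩ := exists_mem_forall_pos Finset.univ s hQconv hne hsQ
  have hSpos : ∀ i ∈ S, 0 < s i z := fun i hi => by
    refine hzpos i (Finset.mem_univ _) ?_
    by_contra hcon
    push Not at hcon
    obtain ⟨w, -, hw, hwi⟩ := hirr i hi
    exact hwi.ne (hw i ((hI i).2 fun y hy => le_antisymm (hcon y hy) (hsQ y hy i)))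
  -- The segment from z to w meets s i = 0 at parameter τ, where i is the only tight inequality of
  -- S. Such a point yields both the dimension of the face and the injectivity of i ↦ Φ i.
  have hpt : ∀ i ∈ S, ∃ p ∈ Q, s i p = 0 ∧ ∀ j ∈ S, j ≠ i → 0 < s j p := by
    intro i hi
    obtain ⟨w, hw1, hw2, hw3⟩ := hirr i hi
    have hd : 0 < s i z - s i w := by linarith [hSpos i hi]
    let τ := s i z / (s i z - s i w)
    have hτ0 : 0 ≤ τ := div_nonneg (hSpos i hi).le hd.le
    have hτ1 : τ < 1 := (div_lt_one hd).2 (by linarith)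
    have hval : ∀ j, s j (AffineMap.lineMap z w τ) = (1 - τ) * s j z + τ * s j w := fun j => by
      rw [AffineMap.apply_lineMap, AffineMap.lineMap_apply_module]
      rfl
    have h0 : s i (AffineMap.lineMap z w τ) = 0 := by
      rw [hval]
      simp only [τ]
      field_simp
      ring
    have hp : ∀ j ∈ S, j ≠ i → 0 < s j (AffineMap.lineMap z w τ) := fun j hj hji => by
      rw [hval]
      exact add_pos_of_pos_of_nonneg (mul_pos (sub_pos.2 hτ1) (hSpos j hj))
        (mul_nonneg hτ0 (hw1 j hj hji))
    refine ⟨_, hSQ _ (fun j hj => ?_) (fun j hj => ?_), h0, hp⟩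
    · by_cases hji : j = i
      · exact hji ▸ h0.ge
      · exact (hp j hj hji).le
    · rw [hval, hw2 j hj, (hI j).1 hj z hz]
      simp
  let Φ : ι → Set (Fin e → ℝ) := fun i => {y ∈ Q | s i y = 0}
  have hfacet : ∀ i ∈ S, Φ i ∈ facets Q := by
    intro i hi
    obtain ⟨p, hp, hp0, hppos⟩ := hpt i hi
    have hpΦ : p ∈ Φ i := ⟨hp, hp0⟩
    refine ⟨fun _ => ⟨LinearMap.toContinuousLinearMap (-(s i).linear), ?_⟩, ?_⟩
    · have hlin : ∀ y, (LinearMap.toContinuousLinearMap (-(s i).linear)) y = s i 0 - s i y :=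
        fun y => by
          rw [AffineMap.apply_eq_zero_add_linear (s i) y]
          simp
      ext y
      simp only [hlin, sub_le_sub_iff_left, Φ, Set.mem_ofPred_eq]
      refine and_congr_right fun hy => ⟨fun h0 x hx => h0 ▸ hsQ x hx i, fun hle => ?_⟩
      exact le_antisymm (hp0 ▸ hle p hp) (hsQ y hy i)
    · rw [affineDim_of_nonempty ⟨p, hpΦ⟩, affineDim_of_nonempty hne]
      -- The direction of Φ i is the kernel of a nonzero functional on W, so it has codimension one.
      set W := vectorSpan ℝ Q with hW
      let f : Module.Dual ℝ W := (s i).linear ∘ₗ W.subtype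
      have hf : f ≠ 0 := fun hf0 => by
        have h1 := LinearMap.congr_fun hf0 ⟨z -ᵥ p, vsub_mem_vectorSpan ℝ hz hp⟩
        have h2 : (s i).linear (z -ᵥ p) = 0 := h1
        rw [AffineMap.linearMap_vsub, vsub_eq_sub, hp0, sub_zero] at h2
        exact (hSpos i hi).ne' h2
      have hspan : vectorSpan ℝ (Φ i) = (LinearMap.ker f).map W.subtype := by
        refine le_antisymm (fun v hv => ?_) ?_
        · refine ⟨⟨v, vectorSpan_mono ℝ (fun x hx => hx.1) hv⟩, ?_, rfl⟩
          exact vectorSpan_le_ker_linear (s i) (fun x hx => hx.2) hv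
        · rintro _ ⟨⟨v, hvW⟩, hv, rfl⟩
          have hv0 : (s i).linear v = 0 := hv
          obtain ⟨ε, hε, hpos⟩ := exists_pos_forall_apply_add_smul_pos s p v
          have hval : ∀ j, (s j).linear v = 0 → s j (p + ε • v) = s j p := fun j hj => by
            rw [AffineMap.apply_add, map_smul, hj, smul_zero, add_zero]
          have hmem : p + ε • v ∈ Φ i := by
            refine ⟨hSQ _ (fun j hj => ?_) (fun j hj => ?_), (hval i hv0).trans hp0⟩
            · by_cases hji : j = i
              · subst hji
                rw [hval j hv0, hp0]
              · exact (hpos j (hppos j hj hji)).le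
            · rw [hval j (vectorSpan_le_ker_linear (s j) ((hI j).1 hj) hvW)]
              exact (hI j).1 hj p hp
          have h1 := vsub_mem_vectorSpan ℝ hmem hpΦ
          rw [vsub_eq_sub, add_sub_cancel_left] at h1
          exact (Submodule.smul_mem_iff _ hε.ne').1 h1
      rw [hspan,
        ← (Submodule.equivMapOfInjective W.subtype W.injective_subtype (LinearMap.ker f)).finrank_eq,
        ← Module.Dual.finrank_ker_add_one_of_ne_zero hf]
      push_cast
      ring
  have hinj : Set.InjOn Φ S := by
    intro i hi j hj hij
    by_contra hne'
    obtain ⟨p, hp, hp0, hppos⟩ := hpt i hi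
    have : p ∈ Φ j := hij ▸ (⟨hp, hp0⟩ : p ∈ Φ i)
    exact (hppos j hj (Ne.symm hne')).ne' this.2
  rw [← Set.encard_coe_eq_coe_finsetCard, ← hinj.encard_image]
  exact Set.encard_le_encard (by rintro _ ⟨i, hi, rfl⟩; exact hfacet i hi)

/-! ### Conversions between formulations, extensions and generating sets -/

theorem isSlackGeneratingSet_image {m d : ℕ} {ι : Type*} [Fintype ι] {P : Set (Fin d → ℝ)}
    {A : Matrix (Fin m) (Fin d) ℝ} {b : Fin m → ℝ} (t : ι → Fin m → ℝ) (ht : ∀ j, 0 ≤ t j)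
    (h : ∀ x ∈ P, ∃ c : ι → ℝ, (∀ j, 0 ≤ c j) ∧ slackMap A b x = ∑ j, c j • t j) :
    ∃ T : Finset (Fin m → ℝ), IsSlackGeneratingSet P A b T ∧ T.card ≤ Fintype.card ι := by
  classical
  refine ⟨Finset.univ.image t, ⟨?_, ?_⟩, Finset.card_image_le⟩
  · intro v hv
    obtain ⟨j, -, rfl⟩ := Finset.mem_image.1 hv
    exact ht j
  · rintro _ ⟨x, hx, rfl⟩
    obtain ⟨c, hc, hs⟩ := h x hx
    -- t need not be injective: coefficients of equal vectors are added.
    refine ⟨fun v => ∑ j with t j = v, c j, fun v _ => Finset.sum_nonneg fun j _ => hc j, ?_⟩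
    rw [hs, ← Finset.sum_fiberwise_of_maps_to (t := Finset.univ.image t) (g := t)
      (fun j _ => Finset.mem_image_of_mem t (Finset.mem_univ j))]
    refine Finset.sum_congr rfl fun v _ => ?_
    rw [Finset.sum_smul]
    refine Finset.sum_congr rfl fun j hj => ?_
    rw [(Finset.mem_filter.1 hj).2]

/-- The slack vectors of a polytope are generated by as many vectors as there are inequalities in
an extended formulation. -/
theorem ExtendedFormulation.exists_isSlackGeneratingSet {d m : ℕ} {P : Set (Fin d → ℝ)}
    (E : ExtendedFormulation P) (hP : IsCompact P) (hnt : P.Nontrivial)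
    {A : Matrix (Fin m) (Fin d) ℝ} {b : Fin m → ℝ} (hAb : polyhedron A b = P) :
    ∃ T : Finset (Fin m → ℝ), IsSlackGeneratingSet P A b T ∧ T.card ≤ E.size := by
  obtain ⟨x₀, hx₀⟩ := hnt.nonempty
  rw [← E.image_eq] at hx₀
  obtain ⟨y₀, ⟨-, hy₀⟩, -⟩ := hx₀
  -- Parametrizing the solutions of the equations from y₀ eliminates them, so only inequalities get
  -- multipliers.
  let W := LinearMap.ker E.D.mulVecLin
  let shift : W →ᵃ[ℝ] (Fin E.e → ℝ) := AffineMap.const ℝ W y₀ + W.subtype.toAffineMap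
  have hshift : ∀ w, shift w = y₀ + w := fun w => rfl
  let s : Fin E.size → W →ᵃ[ℝ] ℝ := fun j => (slackFun E.C E.g j).comp shift
  have hs : ∀ w, (∀ j, 0 ≤ s j w) ↔ E.C *ᵥ (shift w) ≤ E.g := fun w =>
    (mem_polyhedron_iff E.C E.g (shift w)).symm
  have hW : ∀ w, E.D *ᵥ (shift w) = E.h := fun w => by
    have : E.D *ᵥ (w : Fin E.e → ℝ) = 0 := w.2
    rw [hshift, Matrix.mulVec_add, hy₀, this, add_zero]
  have himage : (E.π.comp shift) '' {w | ∀ j, 0 ≤ s j w} = P := by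
    refine Eq.trans ?_ E.image_eq
    ext x
    constructor
    · rintro ⟨w, hw, rfl⟩
      exact ⟨shift w, ⟨(hs w).1 hw, hW w⟩, rfl⟩
    · rintro ⟨y, ⟨hy1, hy2⟩, rfl⟩
      have hmem : y - y₀ ∈ W := by
        rw [LinearMap.mem_ker, map_sub, Matrix.mulVecLin_apply, Matrix.mulVecLin_apply, hy2, hy₀,
          sub_self]
      have hy : shift ⟨y - y₀, hmem⟩ = y := by simp [hshift]
      exact ⟨⟨y - y₀, hmem⟩, (hs _).2 (by rwa [hy]), by rw [AffineMap.comp_apply, hy]⟩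
  have hslack : ∀ x ∈ P, ∀ i, 0 ≤ slackFun A b i x := fun x hx =>
    (mem_polyhedron_iff A b x).1 (hAb ▸ hx)
  choose c hc hcs using fun i => nonneg_comp_eq_sum s (E.π.comp shift) himage hP hnt
    (slackFun A b i) fun x hx => hslack x hx i
  have := isSlackGeneratingSet_image (P := P) (A := A) (b := b) (fun j i => c i j)
    (fun j i => hc i j) (fun x hx => by
      rw [← himage] at hx
      obtain ⟨w, hw, rfl⟩ := hx
      refine ⟨fun j => s j w, hw, funext fun i => ?_⟩
      have h1 := hcs i w
      rw [slackFun_apply] at h1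
      rw [slackMap, Pi.sub_apply, h1]
      simp [mul_comm])
  simpa using this

/-- The facets of an extension give an extended formulation of at most the same size. -/
theorem PolytopeExtension.exists_extendedFormulation {d : ℕ} {P : Set (Fin d → ℝ)}
    (X : PolytopeExtension P) (hne : P.Nonempty) :
    ∃ E : ExtendedFormulation P, (E.size : ℕ∞) ≤ (facets X.Q).encard := by
  obtain ⟨-, m, A, b, hAb⟩ := X.isPolytope
  have hQ : X.Q = {y | ∀ i, 0 ≤ slackFun A b i y} := by
    rw [← hAb]
    exact Set.ext fun y => mem_polyhedron_iff A b y
  have hQne : X.Q.Nonempty := by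
    rw [← X.image_eq] at hne
    exact hne.of_image
  obtain ⟨S, I, hSI, hcard⟩ := exists_card_le_encard_facets _ hQ hQne
  obtain ⟨E, hE⟩ := _root_.exists_extendedFormulation (P := P)
    (fun i : S => slackFun A b i) (fun i : I => slackFun A b i) X.π (by
      refine Eq.trans ?_ X.image_eq
      rw [hSI]
      simp)
  refine ⟨E, ?_⟩
  rwa [hE, Fintype.card_coe]

/-- A bounded nonempty polyhedron is described by a matrix with trivial kernel. -/
theorem ker_mulVecLin_eq_bot {m d : ℕ} {A : Matrix (Fin m) (Fin d) ℝ} {b : Fin m → ℝ}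
    (hb : Bornology.IsBounded (polyhedron A b)) (hne : (polyhedron A b).Nonempty) :
    LinearMap.ker A.mulVecLin = ⊥ := by
  rw [Submodule.eq_bot_iff]
  intro v hv
  have hv : A *ᵥ v = 0 := hv
  obtain ⟨x, hx⟩ := hne
  have hx : A *ᵥ x ≤ b := hx
  have hmem : ∀ τ : ℝ, x + τ • v ∈ polyhedron A b := fun τ => by
    change A *ᵥ (x + τ • v) ≤ b
    rwa [Matrix.mulVec_add, Matrix.mulVec_smul, hv, smul_zero, add_zero]
  obtain ⟨R, hR⟩ := hb.subset_closedBall x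
  by_contra hv0
  have hpos : 0 < ‖v‖ := norm_pos_iff.2 hv0
  have h1 := hR (hmem ((|R| + 1) / ‖v‖))
  rw [Metric.mem_closedBall, dist_eq_norm, add_sub_cancel_left, norm_smul, Real.norm_eq_abs,
    abs_of_pos (by positivity), div_mul_cancel₀ _ hpos.ne'] at h1
  linarith [le_abs_self R]

/-- A slack generating set yields an extension whose facets are indexed by it. -/
theorem IsSlackGeneratingSet.exists_polytopeExtension {d m : ℕ} {P : Set (Fin d → ℝ)}
    (hP : Bornology.IsBounded P) (hnt : P.Nontrivial) {A : Matrix (Fin m) (Fin d) ℝ}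
    {b : Fin m → ℝ} (hAb : polyhedron A b = P) {T : Finset (Fin m → ℝ)}
    (hT : IsSlackGeneratingSet P A b T) :
    ∃ X : PolytopeExtension P, (facets X.Q).encard ≤ T.card := by
  classical
  -- A zero generator would leave its coefficient unbounded.
  let T' := T.erase 0
  let t : Fin T'.card → Fin m → ℝ := fun j => T'.equivFin.symm j
  have ht : ∀ j, t j ≠ 0 ∧ 0 ≤ t j := fun j => by
    have h1 := Finset.mem_erase.1 (T'.equivFin.symm j).2
    exact ⟨h1.1, hT.1 _ h1.2⟩
  have hgen : ∀ x ∈ P, ∃ c : Fin T'.card → ℝ, (∀ j, 0 ≤ c j) ∧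
      slackMap A b x = ∑ j, c j • t j := fun x hx => by
    obtain ⟨c, hc, h⟩ := hT.2 _ ⟨x, hx, rfl⟩
    refine ⟨fun j => c (t j), fun j => hc _ (Finset.mem_of_mem_erase (T'.equivFin.symm j).2), ?_⟩
    rw [h, ← Finset.sum_erase T (a := 0) (by simp), ← Finset.sum_coe_sort]
    exact (Equiv.sum_comp T'.equivFin.symm
      fun v : T' => c (v : Fin m → ℝ) • (v : Fin m → ℝ)).symm
  have hker : LinearMap.ker A.mulVecLin = ⊥ :=
    ker_mulVecLin_eq_bot (hAb ▸ hP) (hAb ▸ hnt.nonempty)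
  obtain ⟨L, hL⟩ := LinearMap.exists_leftInverse_of_injective A.mulVecLin hker
  have hLA : ∀ x, L (A *ᵥ x) = x := fun x => LinearMap.congr_fun hL x
  let comb : (Fin T'.card → ℝ) →ₗ[ℝ] (Fin m → ℝ) := Fintype.linearCombination ℝ t
  have hcomb : ∀ c, comb c = ∑ j, c j • t j := fun c => Fintype.linearCombination_apply ℝ t c
  let rhs : (Fin T'.card → ℝ) →ᵃ[ℝ] (Fin m → ℝ) :=
    AffineMap.const ℝ _ b - comb.toAffineMap
  have hrhs : ∀ c, rhs c = b - ∑ j, c j • t j := fun c => by rw [← hcomb]; rfl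
  let π : (Fin T'.card → ℝ) →ᵃ[ℝ] (Fin d → ℝ) := L.toAffineMap.comp rhs
  let s : Fin T'.card → (Fin T'.card → ℝ) →ᵃ[ℝ] ℝ := fun j =>
    (LinearMap.proj j : (Fin T'.card → ℝ) →ₗ[ℝ] ℝ).toAffineMap
  have hs : ∀ j c, s j c = c j := fun j c => rfl
  -- The equations say that b - ∑ c_j t_j lies in the range of A; L then recovers the point x.
  let h : Fin m → (Fin T'.card → ℝ) →ᵃ[ℝ] ℝ := fun k =>
    (LinearMap.proj k : (Fin m → ℝ) →ₗ[ℝ] ℝ).toAffineMap.comp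
      (A.mulVecLin.toAffineMap.comp π - rhs)
  have hh : ∀ c, (∀ k, h k c = 0) ↔ A *ᵥ (π c) = rhs c := fun c => by
    rw [← sub_eq_zero, funext_iff]
    exact Iff.rfl
  let Q : Set (Fin T'.card → ℝ) := {c | (∀ j, 0 ≤ s j c) ∧ ∀ k, h k c = 0}
  have hslack : ∀ c ∈ Q, slackMap A b (π c) = ∑ j, c j • t j := fun c hc => by
    rw [slackMap, (hh c).1 hc.2, hrhs, sub_sub_cancel]
  have himage : π '' Q = P := by
    ext x
    constructor
    · rintro ⟨c, hc, rfl⟩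
      rw [← hAb]
      have h1 : 0 ≤ slackMap A b (π c) := by
        rw [hslack c hc]
        exact Finset.sum_nonneg fun j _ => smul_nonneg (hc.1 j) (ht j).2
      exact sub_nonneg.1 h1
    · intro hx
      obtain ⟨c, hc, hcs⟩ := hgen x hx
      have h1 : rhs c = A *ᵥ x := by rw [hrhs, ← hcs, slackMap, sub_sub_cancel]
      have h2 : π c = x := by
        change L (rhs c) = x
        rw [h1, hLA]
      exact ⟨c, ⟨hc, (hh c).2 (by rw [h2, h1])⟩, h2⟩
  have hbdd : Bornology.IsBounded Q := by
    have hcont : Continuous (slackMap A b) := by unfold slackMap; fun_prop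
    have hcomp : IsCompact P := by
      rw [← hAb] at hP ⊢
      exact Metric.isCompact_of_isClosed_isBounded (isClosed_polyhedron A b) hP
    obtain ⟨M, hM⟩ := (hcomp.image hcont).isBounded.exists_norm_le
    -- Each t j has a positive entry, and slacks are bounded on P, so each coefficient is bounded.
    choose k hk using fun j => Function.ne_iff.1 (ht j).1
    have hk : ∀ j, 0 < t j (k j) := fun j => ((ht j).2 (k j)).lt_of_ne (Ne.symm (hk j))
    refine (Metric.isBounded_Icc (0 : Fin T'.card → ℝ) (fun j => M / t j (k j))).subset ?_
    intro c hc
    refine ⟨hc.1, fun j => ?_⟩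
    rw [le_div_iff₀ (hk j)]
    have h1 : slackMap A b (π c) (k j) ≤ M :=
      (le_abs_self _).trans ((norm_le_pi_norm _ (k j)).trans
        (hM _ ⟨π c, himage ▸ ⟨c, hc, rfl⟩, rfl⟩))
    rw [hslack c hc, Finset.sum_apply] at h1
    exact (Finset.single_le_sum (f := fun j' => (c j' • t j') (k j))
      (fun j' _ => mul_nonneg (hc.1 j') ((ht j').2 (k j))) (Finset.mem_univ j)).trans h1
  have hpoly : IsPolytope Q := by
    refine ⟨hbdd, ?_⟩
    obtain ⟨m', C, g, hC⟩ := exists_polyhedron_eq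
      (Sum.elim s (Sum.elim h fun k => -h k))
    refine ⟨m', C, g, hC.trans (Set.ext fun c => ?_)⟩
    simp only [Set.mem_ofPred_eq, Sum.forall, Sum.elim_inl, Sum.elim_inr, Q]
    refine and_congr_right fun _ => ⟨fun hc k => ?_, fun hc => ⟨fun k => (hc k).ge, fun k => ?_⟩⟩
    · have h1 : 0 ≤ -(h k c) := hc.2 k
      linarith [hc.1 k]
    · change 0 ≤ -(h k c)
      rw [hc k, neg_zero]
  have hQnt : Q.Nontrivial := Set.nontrivial_of_image π Q (himage ▸ hnt)
  refine ⟨⟨_, Q, hpoly, π, himage⟩, ?_⟩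
  have hsub : facets Q ⊆ Set.range fun j => {c ∈ Q | s j c = 0} := fun F hF => by
    obtain ⟨j, hj⟩ := exists_eq_of_mem_facets s h rfl (one_le_affineDim_of_nontrivial hQnt) hF
    exact ⟨j, hj.symm⟩
  have hcard : (Set.range fun j => {c ∈ Q | s j c = 0}).encard ≤ T'.card := by
    rw [← Set.image_univ]
    refine (Set.encard_image_le _ _).trans ?_
    simp
  refine (Set.encard_le_encard hsub).trans (hcard.trans ?_)
  exact_mod_cast Finset.card_le_card (Finset.erase_subset 0 T)

/-- For a polytope `P` of dimension at least `1` and any system `A x ≤ b` defining it, the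
extension complexity of `P`, be it the minimum size of an extended formulation or the minimum
number of facets of an extension, is the minimum size of a slack generating set. -/
theorem theorem1 {d m : ℕ} (P : Set (Fin d → ℝ)) (hP : IsPolytope P) (hdim : 1 ≤ affineDim P)
    (A : Matrix (Fin m) (Fin d) ℝ) (b : Fin m → ℝ) (hAb : polyhedron A b = P) :
    IsLeast {r : ℕ | ∃ E : ExtendedFormulation P, E.size = r} (extensionComplexity P) ∧
    IsLeast {r : ℕ | ∃ X : PolytopeExtension P, (facets X.Q).encard = (r : ℕ∞)}
      (extensionComplexity P) ∧
    IsLeast {r : ℕ | ∃ T : Finset (Fin m → ℝ), IsSlackGeneratingSet P A b T ∧ T.card = r}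
      (extensionComplexity P) := by
  have hnt := nontrivial_of_one_le_affineDim hdim
  have hslack : ∀ E : ExtendedFormulation P, ∃ T : Finset (Fin m → ℝ),
      IsSlackGeneratingSet P A b T ∧ T.card ≤ E.size :=
    fun E => E.exists_isSlackGeneratingSet hP.isCompact hnt hAb
  have hlb : ∀ E : ExtendedFormulation P, extensionComplexity P ≤ E.size :=
    fun E => Nat.sInf_le ⟨E, rfl⟩
  have hext_lb : ∀ X : PolytopeExtension P,
      (extensionComplexity P : ℕ∞) ≤ (facets X.Q).encard := fun X => by
    obtain ⟨E, hE⟩ := X.exists_extendedFormulation hnt.nonempty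
    exact le_trans (by exact_mod_cast hlb E) hE
  have hslack_lb : ∀ T : Finset (Fin m → ℝ), IsSlackGeneratingSet P A b T →
      extensionComplexity P ≤ T.card := fun T hT => by
    obtain ⟨X, hX⟩ := hT.exists_polytopeExtension hP.1 hnt hAb
    exact_mod_cast (hext_lb X).trans hX
  -- `sInf` of an empty set would be 0; the identity extension shows that formulations exist.
  have hne : ∃ E : ExtendedFormulation P, E.size = extensionComplexity P := by
    refine Nat.sInf_mem (s := {r | ∃ E : ExtendedFormulation P, E.size = r}) ?_
    obtain ⟨E, -⟩ := PolytopeExtension.exists_extendedFormulation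
      ⟨d, P, hP, AffineMap.id ℝ _, by simp⟩ hnt.nonempty
    exact ⟨E.size, E, rfl⟩
  obtain ⟨E, hE⟩ := hne
  obtain ⟨T, hT, hTE⟩ := hslack E
  rw [hE] at hTE
  have hTcard : T.card = extensionComplexity P := le_antisymm hTE (hslack_lb T hT)
  obtain ⟨X, hX⟩ := hT.exists_polytopeExtension hP.1 hnt hAb
  refine ⟨⟨⟨E, hE⟩, ?_⟩, ⟨⟨X, le_antisymm (hTcard ▸ hX) (hext_lb X)⟩, ?_⟩, ⟨⟨T, hT, hTcard⟩, ?_⟩⟩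
  · rintro _ ⟨E', rfl⟩
    exact hlb E'
  · rintro r ⟨X', hX'⟩
    exact_mod_cast hX' ▸ hext_lb X'
  · rintro _ ⟨T', hT', rfl⟩
    exact hslack_lb T' hT'
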